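/- Let $L(sl_2)=sl_2(\mathbb{C})\otimes\mathbb{C}[t,t^{-1}]$ be the $sl_2$ loop algebra, with generators $x_k^{+}=e\otimes t^k$, $x_k^{-}=f\otimes t^k$, $h_k=h\otimes t^k$ ($k\in\mathbb{Z}$), so that $[h_j,x_k^{\pm}]=\pm2x_{j+k}^{\pm}$, $[x_j^{+},x_k^{-}]=h_{j+k}$ and $[h_j,h_k]=[x_j^{\pm},x_k^{\pm}]=0$. Let $\Omega\neq0$ be a highest weight vector in a complex representation of $L(sl_2)$, that is, $x_k^{+}\Omega=0$ and $h_k\Omega\in\mathbb{C}\,\Omega$ for all $k\in\mathbb{Z}$, and assume that the subrepresentation $V_\Omega$ generated by $\Omega$ is finite-dimensional. Let $r\in\mathbb{Z}_{\ge0}$ be the eigenvalue of $h_0$ on $\Omega$, let $\lambda_j\in\mathbb{C}$ be defined by $$\frac{(x_0^{+})^{j}}{j!}\,\frac{(x_1^{-})^{j}}{j!}\,\Omega=\lambda_j\,\Omega\qquad(0\le j\le r),$$ and put $P_\Omega(u)=\sum_{k=0}^{r}\lambda_k(-u)^k$. Let $a_1,\dots,a_s$ be the evaluation parameters of $\Omega$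 and $m_1,\dots,m_s$ their multiplicities, that is, $$P_\Omega(u)=\prod_{j=1}^{s}(1-a_ju)^{m_j}$$ with $a_1,\dots,a_s\in\mathbb{C}$ distinct and nonzero and with integers $m_j\ge1$. Put $$x_s^{-}(\boldsymbol a)=\sum_{k=0}^{s}(-1)^k\Bigl(\sum_{1\le i_1<\cdots<i_k\le s}a_{i_1}\cdots a_{i_k}\Bigr)x_{s-k}^{-}.$$ Then $V_\Omega$ is irreducible if and only if $x_s^{-}(\boldsymbol a)\,\Omega=0$. -/

import Mathlib

open scoped TensorProduct

noncomputable section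

namespace Sl2Loop

/-- The Lie algebra `sl₂(ℂ)` of traceless complex `2 × 2` matrices. -/
abbrev Sl2 : Type := LieAlgebra.SpecialLinear.sl (Fin 2) ℂ

/-- The `sl₂` loop algebra `L(sl₂) = ℂ[t, t⁻¹] ⊗ sl₂(ℂ)`. Its representations, i.e. those of its
universal enveloping algebra, are its Lie modules. -/
abbrev LoopSl2 : Type := LieAlgebra.loopAlgebra ℂ ℤ Sl2

/-- The matrix unit `E₁₂`. -/
def e : Sl2 := LieAlgebra.SpecialLinear.single (R := ℂ) (0 : Fin 2) 1 (by decide) 1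

/-- The matrix unit `E₂₁`. -/
def f : Sl2 := LieAlgebra.SpecialLinear.single (R := ℂ) (1 : Fin 2) 0 (by decide) 1

/-- The diagonal matrix `E₁₁ - E₂₂`. -/
def h : Sl2 := LieAlgebra.SpecialLinear.singleSubSingle (R := ℂ) (0 : Fin 2) 1 1

/-- The element `tᵏ ⊗ y` of the loop algebra. -/
def gen (y : Sl2) (k : ℤ) : LoopSl2 := (AddMonoidAlgebra.single k (1 : ℂ)) ⊗ₜ[ℂ] y

/-- The generator `x_k⁺ = tᵏ ⊗ e`. -/
def xPlus (k : ℤ) : LoopSl2 := gen e k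

/-- The generator `x_k⁻ = tᵏ ⊗ f`. -/
def xMinus (k : ℤ) : LoopSl2 := gen f k

/-- The generator `h_k = tᵏ ⊗ h`. -/
def hGen (k : ℤ) : LoopSl2 := gen h k

theorem gen_lie_gen (y z : Sl2) (j k : ℤ) : ⁅gen y j, gen z k⁆ = gen ⁅y, z⁆ (j + k) := by
  unfold gen
  rw [LieAlgebra.ExtendScalars.bracket_tmul, AddMonoidAlgebra.single_mul_single, one_mul]

theorem e_lie_f : ⁅e, f⁆ = h := by
  apply Subtype.ext
  ext i j
  fin_cases i <;> fin_cases j <;> simp [e, f, h, Ring.lie_def]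

theorem h_lie_e : ⁅h, e⁆ = (2 : ℂ) • e := by
  apply Subtype.ext
  ext i j
  fin_cases i <;> fin_cases j <;> norm_num [e, h, Ring.lie_def]

theorem h_lie_f : ⁅h, f⁆ = (-2 : ℂ) • f := by
  apply Subtype.ext
  ext i j
  fin_cases i <;> fin_cases j <;> norm_num [f, h, Ring.lie_def]

theorem hGen_lie_xPlus (j k : ℤ) : ⁅hGen j, xPlus k⁆ = (2 : ℂ) • xPlus (j + k) := by
  rw [hGen, xPlus, gen_lie_gen, h_lie_e]
  exact TensorProduct.tmul_smul _ _ _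

theorem hGen_lie_xMinus (j k : ℤ) : ⁅hGen j, xMinus k⁆ = (-2 : ℂ) • xMinus (j + k) := by
  rw [hGen, xMinus, gen_lie_gen, h_lie_f]
  exact TensorProduct.tmul_smul _ _ _

theorem xPlus_lie_xMinus (j k : ℤ) : ⁅xPlus j, xMinus k⁆ = hGen (j + k) := by
  rw [xPlus, xMinus, gen_lie_gen, e_lie_f, hGen]

theorem gen_lie_gen_self (y : Sl2) (j k : ℤ) : ⁅gen y j, gen y k⁆ = 0 := by
  rw [gen_lie_gen, lie_self, gen, TensorProduct.tmul_zero]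

/-- The generator with parameters
`x_m⁻(α) = ∑_{k=0}^{m} (-1)ᵏ e_k(α₁, …, α_m) x_{m-k}⁻`, where `e_k` is the `k`-th elementary
symmetric polynomial. -/
def xMinusParam {m : ℕ} (α : Fin m → ℂ) : LoopSl2 :=
  ∑ k ∈ Finset.range (m + 1),
    ((-1 : ℂ) ^ k * ∑ I ∈ Finset.powersetCard k (Finset.univ : Finset (Fin m)), ∏ i ∈ I, α i) •
      xMinus ((m : ℤ) - (k : ℤ))

variable {V : Type*} [AddCommGroup V] [Module ℂ V] [LieRingModule LoopSl2 V]

/-- A highest weight vector: a nonzero vector annihilated by all `x_k⁺`, and a simultaneous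
eigenvector of all `h_k`, `k ∈ ℤ`. -/
structure IsHighestWeightVector (Ω : V) : Prop where
  ne_zero : Ω ≠ 0
  xPlus_lie (k : ℤ) : ⁅xPlus k, Ω⁆ = 0
  hGen_lie (k : ℤ) : ∃ d : ℂ, ⁅hGen k, Ω⁆ = d • Ω

/-- The representation `V_Ω` generated by `Ω`. -/
abbrev genRep (Ω : V) : LieSubmodule ℂ LoopSl2 V := LieSubmodule.lieSpan ℂ LoopSl2 {Ω}

variable [LieModule ℂ LoopSl2 V]

/-- The operator `y^(n) = yⁿ / n!` on a representation. -/
def divPow (y : LoopSl2) (n : ℕ) : V →ₗ[ℂ] V :=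
  ((n.factorial : ℂ)⁻¹) • (LieModule.toEnd ℂ LoopSl2 V y) ^ n

/-- The number `r` with `h₀ Ω = r Ω`. It exists and is unique if `Ω` is a highest weight vector
that generates a finite-dimensional representation. -/
def weight (Ω : V) : ℕ := Classical.epsilon fun r : ℕ => ⁅hGen 0, Ω⁆ = (r : ℂ) • Ω

/-- The number `λ_j` with `(x₀⁺)^(j) (x₁⁻)^(j) Ω = λ_j Ω`. It exists and is unique if `Ω` is a
highest weight vector. -/
def eigenval (Ω : V) (j : ℕ) : ℂ :=
  Classical.epsilon fun c : ℂ => divPow (xPlus 0) j (divPow (xMinus 1) j Ω) = c • Ω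

/-- The Drinfeld polynomial `P_Ω(u) = ∑_{k=0}^{r} λ_k (-u)ᵏ`. -/
def drinfeldPoly (Ω : V) : Polynomial ℂ :=
  ∑ k ∈ Finset.range (weight Ω + 1), Polynomial.C (eigenval Ω k) * (-Polynomial.X) ^ k

/-- `Ω` has the evaluation parameters `a₁, …, a_s` with the multiplicities `m₁, …, m_s`: the `a_j`
are distinct and nonzero, the `m_j` are positive, and `P_Ω(u) = ∏_j (1 - a_j u)^{m_j}`. -/
structure HasEvaluationParameters (Ω : V) {s : ℕ} (a : Fin s → ℂ) (m : Fin s → ℕ) : Prop where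
  injective : Function.Injective a
  ne_zero (j : Fin s) : a j ≠ 0
  mult_pos (j : Fin s) : 0 < m j
  factorization : drinfeldPoly Ω =
    ∏ j : Fin s, (1 - Polynomial.C (a j) * Polynomial.X) ^ m j

end Sl2Loop

end

/-!
Let `Ω` generate a finite-dimensional highest weight module `M` over `A ⊗ sl₂`. The `p ∈ A` with
`(p ⊗ f) Ω = 0` form an ideal `I`, and `I ⊗ sl₂` kills `M`. The point is that `M` is irreducible if
and only if `I` is a radical ideal.

If `M` is irreducible and `p² ∈ I`, then `(1 ⊗ e) (p ⊗ f)ⁿ⁺¹ Ω` is `(n + 1) D(p) (p ⊗ f)ⁿ Ω`, where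
`D(p)` is the eigenvalue of `p ⊗ h`. As `p ⊗ f` is nilpotent, `D(p) = 0`, and the same holds for
every multiple of `p`. Hence `(p ⊗ f) Ω` is singular, and irreducibility forces it to vanish.
Conversely, if `I` is radical, then `A ⧸ I` is a product of copies of `ℂ` and its primitive
idempotents split the action into commuting copies of `sl₂`. The Casimir element of each copy is a
scalar, which forces every singular vector to have the weight of `Ω`.

In the radical case the Drinfeld polynomial is the product of those of the copies of `sl₂`, namely
`∏ (1 - φᵢ(t) u)^{nᵢ}` for the characters `φᵢ` of `A ⧸ I`. Since `x_s⁻(a) = ∏ (t - aⱼ) ⊗ f`, the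
condition `x_s⁻(a) Ω = 0` says that `∏ (t - aⱼ)` lies in `I`; this polynomial is squarefree, so `I`
is then radical.
-/

noncomputable section

namespace Sl2Loop

open Module

attribute [local instance] LieRing.ofAssociativeRing

section WeightShift

variable {K V : Type*} [Field K] [AddCommGroup V] [Module K V]

theorem apply_pow_apply_of_lie_eq_smul {g x : End K V} {c μ : K} {v : V} (hx : ⁅g, x⁆ = c • x)
    (hv : g v = μ • v) (n : ℕ) : g ((x ^ n) v) = (μ + n * c) • (x ^ n) v := by
  have hgx (w : V) : g (x w) = x (g w) + c • x w := by
    rw [add_comm, ← sub_eq_iff_eq_add]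
    exact LinearMap.congr_fun hx w
  induction n with
  | zero => simpa using hv
  | succ n ih =>
    rw [pow_succ', End.mul_apply, hgx, ih, map_smul, ← add_smul]
    push_cast
    ring_nf

variable [CharZero K] [FiniteDimensional K V]

theorem exists_not_hasEigenvalue_add_natCast_mul (g : End K V) (μ : K)
    {c : K} (hc : c ≠ 0) : ∃ n : ℕ, ¬ g.HasEigenvalue (μ + n * c) := by
  by_contra! hall
  refine Set.infinite_of_injective_forall_mem (fun m n hmn => ?_) hall g.finite_hasEigenvalue
  simpa [hc] using hmn

theorem exists_hasEigenvalue_not_hasEigenvalue_add {g : End K V} {μ : K}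
    (hμ : g.HasEigenvalue μ) {c : K} (hc : c ≠ 0) :
    ∃ ν, g.HasEigenvalue ν ∧ ¬ g.HasEigenvalue (ν + c) := by
  obtain ⟨n, hn, hn'⟩ := Nat.exists_not_and_succ_of_not_zero_of_exists
    (p := fun n : ℕ => ¬ g.HasEigenvalue (μ + n * c)) (by simpa using hμ)
    (exists_not_hasEigenvalue_add_natCast_mul g μ hc)
  exact ⟨μ + n * c, not_not.mp hn, by simpa [add_mul, add_assoc] using hn'⟩

theorem exists_pow_apply_eq_zero_of_lie_eq_smul {g x : End K V} {c μ : K}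
    {v : V} (hc : c ≠ 0) (hx : ⁅g, x⁆ = c • x) (hv : g v = μ • v) : ∃ n : ℕ, (x ^ n) v = 0 := by
  obtain ⟨n, hn⟩ := exists_not_hasEigenvalue_add_natCast_mul g μ hc
  refine ⟨n, of_not_not fun hne => hn ?_⟩
  exact End.hasEigenvalue_of_hasEigenvector
    ⟨End.mem_eigenspace_iff.mpr (apply_pow_apply_of_lie_eq_smul hx hv n), hne⟩

end WeightShift

section DividedPower

open scoped Nat

variable {K R : Type*} [Field K] [Ring R] [Algebra K R]

variable (K) in
/-- The divided power `xⁿ / n!`, with the factorial taken in the coefficient field `K`. -/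
def dividedPower (x : R) (n : ℕ) : R := (n ! : K)⁻¹ • x ^ n

theorem dividedPower_smul (b : K) (x : R) (n : ℕ) :
    dividedPower K (b • x) n = b ^ n • dividedPower K x n := by
  rw [dividedPower, dividedPower, smul_pow, smul_comm]

theorem commute_dividedPower {x y : R} (h : Commute x y) (m n : ℕ) :
    Commute (dividedPower K x m) (dividedPower K y n) :=
  ((h.pow_pow m n).smul_left _).smul_right _

theorem dividedPower_add [CharZero K] {x y : R} (h : Commute x y) (n : ℕ) :
    dividedPower K (x + y) n =
      ∑ ij ∈ Finset.HasAntidiagonal.antidiagonal n,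
        dividedPower K x ij.1 * dividedPower K y ij.2 := by
  rw [dividedPower, h.add_pow', Finset.smul_sum]
  refine Finset.sum_congr rfl fun ij hij => ?_
  obtain ⟨i, j⟩ := ij
  obtain rfl : i + j = n := Finset.HasAntidiagonal.mem_antidiagonal.mp hij
  have hchoose : ((i + j).choose i : K) = (i + j)! / (i ! * j !) := Nat.cast_add_choose K
  have hfact : ((i + j)! : K) ≠ 0 := mod_cast (i + j).factorial_ne_zero
  rw [dividedPower, dividedPower, smul_mul_smul_comm, ← Nat.cast_smul_eq_nsmul K, smul_smul,
    hchoose]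
  congr 1
  field_simp

end DividedPower

section Sl2Triple

open scoped Nat

variable {K L V : Type*} [Field K] [LieRing L] [LieAlgebra K L] [AddCommGroup V] [Module K V]
  [LieRingModule L V] [LieModule K L V] {h e f : L} {t : IsSl2Triple h e f} {v : V}

theorem toEnd_e_pow_toEnd_f_pow {μ : K} (hv : t.HasPrimitiveVectorWith v μ) (k : ℕ) :
    (LieModule.toEnd K L V e ^ k) ((LieModule.toEnd K L V f ^ k) v) =
      (k ! * (descPochhammer K k).eval μ) • v := by
  induction k with
  | zero => simp
  | succ k ih =>
    rw [pow_succ (LieModule.toEnd K L V e), End.mul_apply, LieModule.toEnd_apply_apply,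
      hv.lie_e_pow_succ_toEnd_f, map_smul, ih, smul_smul, descPochhammer_succ_eval,
      Nat.factorial_succ]
    push_cast
    ring_nf

theorem dividedPower_e_dividedPower_f [CharZero K] {n : ℕ}
    (hv : t.HasPrimitiveVectorWith v (n : K)) (k : ℕ) :
    dividedPower K (LieModule.toEnd K L V e) k (dividedPower K (LieModule.toEnd K L V f) k v) =
      (n.choose k : K) • v := by
  have hk : (k ! : K) ≠ 0 := mod_cast k.factorial_ne_zero
  rw [dividedPower, dividedPower, LinearMap.smul_apply, LinearMap.smul_apply, map_smul, smul_smul,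
    toEnd_e_pow_toEnd_f_pow hv, smul_smul, Nat.cast_choose_eq_descPochhammer_div]
  congr 1
  field_simp

end Sl2Triple

section Casimir

variable {R : Type*} [Ring R] {h e f : R}

/-- The Casimir element of an `sl₂` triple in an associative algebra, normalised so that it acts as
`μ (μ + 2)` on a primitive vector of weight `μ`. -/
def casimir (h e f : R) : R := h * h + 2 • h + 4 • (f * e)

theorem commute_casimir {x : R} (hh : Commute x h) (he : Commute x e) (hf : Commute x f) :
    Commute x (casimir h e f) :=
  ((hh.mul_right hh).add_right (hh.smul_right 2)).add_right ((hf.mul_right he).smul_right 4)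

theorem commute_h_casimir (t : IsSl2Triple h e f) : Commute h (casimir h e f) := by
  have he : h * e = e * h + 2 • e := sub_eq_iff_eq_add'.mp t.lie_h_e_nsmul
  have hf : h * f = f * h - 2 • f :=
    (sub_eq_iff_eq_add'.mp t.lie_h_f_nsmul).trans (sub_eq_add_neg _ _).symm
  have hfe : Commute h (f * e) := by
    rw [commute_iff_eq, ← mul_assoc, hf, sub_mul, mul_assoc f h, he, mul_assoc]
    noncomm_ring
  exact (((Commute.refl h).mul_right (Commute.refl h)).add_right
    ((Commute.refl h).smul_right 2)).add_right (hfe.smul_right 4)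

theorem commute_e_casimir (t : IsSl2Triple h e f) : Commute e (casimir h e f) := by
  have he : e * h = h * e - 2 • e := by
    rw [← t.lie_h_e_nsmul, Ring.lie_def, sub_sub_cancel]
  have hef : e * f = f * e + h := sub_eq_iff_eq_add'.mp t.lie_e_f
  have hhe : e * (h * h) = h * h * e - 4 • (h * e) + 4 • e := by
    rw [← mul_assoc, he, sub_mul, mul_assoc h, he, smul_mul_assoc, he]
    noncomm_ring
  rw [commute_iff_eq, casimir, mul_add, mul_add, hhe, mul_smul_comm, he, mul_smul_comm, ← mul_assoc,
    hef]
  noncomm_ring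

theorem casimir_symm (t : IsSl2Triple h e f) : casimir (-h) f e = casimir h e f := by
  have hef : e * f = f * e + h := sub_eq_iff_eq_add'.mp t.lie_e_f
  rw [casimir, casimir, hef]
  noncomm_ring

theorem commute_f_casimir (t : IsSl2Triple h e f) : Commute f (casimir h e f) :=
  casimir_symm t ▸ commute_e_casimir t.symm

variable {K V : Type*} [Field K] [AddCommGroup V] [Module K V]

theorem casimir_apply {h e f : End K V} {v : V} (hv : e v = 0) :
    casimir h e f v = h (h v) + (2 : K) • h v := by
  simp [casimir, hv, two_smul]

end Casimir

section PrimitiveIdempotent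

universe u

variable {k : Type*} {A : Type u} [Field k] [CommRing A] [Algebra k A]

/-- Modulo the ideal `I`, `l` is a nonzero idempotent whose multiples are its scalar multiples, the
scalar being given by the character `φ`. -/
structure IsPrimitiveIdempotentMod (I : Ideal A) (l : A) (φ : A →ₐ[k] k) : Prop where
  notMem : l ∉ I
  apply_self : φ l = 1
  mul_sub_smul_mem (g : A) : g * l - φ g • l ∈ I

theorem isPrimitiveIdempotentMod_ker {ι : Type*} [DecidableEq ι] {χ : A →ₐ[k] ι → k} {l : A} {i : ι}
    (hl : χ l = Pi.single i 1) :
    IsPrimitiveIdempotentMod (RingHom.ker χ) l ((Pi.evalAlgHom k (fun _ => k) i).comp χ) where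
  notMem hmem := by
    have h0 := congrFun (hl.symm.trans (RingHom.mem_ker.mp hmem)) i
    simp at h0
  apply_self := by simp [hl]
  mul_sub_smul_mem g := by
    rw [RingHom.mem_ker, map_sub, map_mul, map_smul, hl, sub_eq_zero]
    ext j
    rcases eq_or_ne j i with rfl | hj <;> simp [*]

variable [IsAlgClosed k]

theorem exists_algHom_pi_of_isRadical {I : Ideal A} (hI : I.IsRadical)
    [FiniteDimensional k (A ⧸ I)] :
    ∃ (ι : Type u) (_ : Finite ι) (χ : A →ₐ[k] ι → k),
      Function.Surjective χ ∧ RingHom.ker χ = I := by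
  have : IsReduced (A ⧸ I) := (Ideal.isRadical_iff_quotient_reduced I).mp hI
  have : IsArtinianRing (A ⧸ I) := isArtinian_of_tower k inferInstance
  let _ (m : MaximalSpectrum (A ⧸ I)) : Field ((A ⧸ I) ⧸ m.asIdeal) :=
    Ideal.Quotient.field m.asIdeal
  let ψ : (A ⧸ I) ≃ₐ[k] MaximalSpectrum (A ⧸ I) → k :=
    ((IsArtinianRing.equivPi (A ⧸ I)).restrictScalars k).trans <|
      AlgEquiv.piCongrRight fun _ => (AlgEquiv.ofBijective (Algebra.ofId k _)
        IsAlgClosed.algebraMap_bijective_of_isIntegral).symm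
  refine ⟨_, inferInstance, ψ.toAlgHom.comp (Ideal.Quotient.mkₐ k I),
    ψ.surjective.comp (Ideal.Quotient.mkₐ_surjective k I), ?_⟩
  ext x
  simp [RingHom.mem_ker, Ideal.Quotient.eq_zero_iff_mem]

theorem exists_primitiveIdempotents_of_isRadical {I : Ideal A} (hI : I.IsRadical)
    [FiniteDimensional k (A ⧸ I)] :
    ∃ (ι : Type u) (_ : Fintype ι) (l : ι → A) (φ : ι → A →ₐ[k] k),
      (∀ i, IsPrimitiveIdempotentMod I (l i) (φ i)) ∧ (∀ i j, i ≠ j → l i * l j ∈ I) ∧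
        ∀ q, q - ∑ i, φ i q • l i ∈ I := by
  classical
  obtain ⟨ι, hι, χ, hχ, rfl⟩ := exists_algHom_pi_of_isRadical (k := k) hI
  have := Fintype.ofFinite ι
  choose l hl using fun i : ι => hχ (Pi.single i 1)
  refine ⟨ι, this, l, fun i => (Pi.evalAlgHom k (fun _ => k) i).comp χ,
    fun i => isPrimitiveIdempotentMod_ker (hl i), fun i j hij => ?_, fun q => ?_⟩
  · refine RingHom.mem_ker.mpr ?_
    rw [map_mul, hl, hl]
    ext k
    rcases eq_or_ne k i with rfl | hk <;> simp [*]
  · rw [RingHom.mem_ker, map_sub, map_sum, sub_eq_zero]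
    ext j
    simp [hl, Pi.single_apply]

end PrimitiveIdempotent

section CurrentModule

universe u

variable (A : Type u) (M : Type*) [CommRing A] [Algebra ℂ A] [AddCommGroup M] [Module ℂ M]
  [LieRingModule (A ⊗[ℂ] Sl2) M] [LieModule ℂ (A ⊗[ℂ] Sl2) M]

/-- The action of the current `p ⊗ y` on a module over the current algebra `A ⊗ sl₂`, as an operator
that is linear in `y` and in `p`. -/
def currentEnd : Sl2 →ₗ[ℂ] A →ₗ[ℂ] End ℂ M :=
  (TensorProduct.mk ℂ A Sl2).flip.compr₂
    (LieModule.toEnd ℂ (A ⊗[ℂ] Sl2) M : A ⊗[ℂ] Sl2 →ₗ[ℂ] End ℂ M)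

local notation "E" => currentEnd A M e
local notation "F" => currentEnd A M f
local notation "H" => currentEnd A M h

variable {A M}

theorem lie_currentEnd (y z : Sl2) (p q : A) :
    ⁅currentEnd A M y p, currentEnd A M z q⁆ = currentEnd A M ⁅y, z⁆ (p * q) := by
  refine ((LieModule.toEnd ℂ (A ⊗[ℂ] Sl2) M).map_lie (p ⊗ₜ y) (q ⊗ₜ z)).symm.trans ?_
  rw [LieAlgebra.ExtendScalars.bracket_tmul]
  rfl

theorem lie_H_E (p q : A) : ⁅H p, E q⁆ = (2 : ℂ) • E (p * q) := by
  rw [lie_currentEnd, h_lie_e, map_smul, LinearMap.smul_apply]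

theorem lie_H_F (p q : A) : ⁅H p, F q⁆ = (-2 : ℂ) • F (p * q) := by
  rw [lie_currentEnd, h_lie_f, map_smul, LinearMap.smul_apply]

theorem lie_E_F (p q : A) : ⁅E p, F q⁆ = H (p * q) := by
  rw [lie_currentEnd, e_lie_f]

theorem commute_currentEnd (y : Sl2) (p q : A) :
    Commute (currentEnd A M y p) (currentEnd A M y q) := by
  rw [commute_iff_lie_eq, lie_currentEnd, lie_self, map_zero, LinearMap.zero_apply]

theorem H_E_apply (p q : A) (v : M) : H p (E q v) = E q (H p v) + (2 : ℂ) • E (p * q) v := by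
  rw [add_comm, ← sub_eq_iff_eq_add]
  exact LinearMap.congr_fun (lie_H_E p q) v

theorem H_F_apply (p q : A) (v : M) : H p (F q v) = F q (H p v) + (-2 : ℂ) • F (p * q) v := by
  rw [add_comm, ← sub_eq_iff_eq_add]
  exact LinearMap.congr_fun (lie_H_F p q) v

theorem E_F_apply (p q : A) (v : M) : E p (F q v) = F q (E p v) + H (p * q) v := by
  rw [add_comm, ← sub_eq_iff_eq_add]
  exact LinearMap.congr_fun (lie_E_F p q) v

theorem H_one_E_apply {μ : ℂ} {v : M} (hv : H 1 v = μ • v) (p : A) :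
    H 1 (E p v) = (μ + 2) • E p v := by
  rw [H_E_apply, hv, one_mul, map_smul, add_smul]

theorem H_one_F_apply {μ : ℂ} {v : M} (hv : H 1 v = μ • v) (p : A) :
    H 1 (F p v) = (μ - 2) • F p v := by
  rw [H_F_apply, hv, one_mul, map_smul, ← add_smul, sub_eq_add_neg]

theorem exists_eq_smul_add (y : Sl2) : ∃ c₁ c₂ c₃ : ℂ, y = c₁ • e + c₂ • f + c₃ • h := by
  refine ⟨y.val 0 1, y.val 1 0, y.val 0 0, Subtype.ext ?_⟩
  have htrace : y.val.trace = 0 := y.property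
  rw [Matrix.trace_fin_two] at htrace
  ext i j
  fin_cases i <;> fin_cases j <;> simp [e, f, h]
  linear_combination htrace

theorem lie_mem_of_currentEnd_mem {N : Submodule ℂ M}
    (hN : ∀ y p, ∀ v ∈ N, currentEnd A M y p v ∈ N) (x : A ⊗[ℂ] Sl2) {v : M} (hv : v ∈ N) :
    ⁅x, v⁆ ∈ N := by
  induction x with
  | zero => simp
  | add x y hx hy => exact add_lie x y v ▸ N.add_mem hx hy
  | tmul p y => exact hN y p v hv

theorem lie_mem_of_stable {N : Submodule ℂ M} (hE : ∀ p, ∀ v ∈ N, E p v ∈ N)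
    (hF : ∀ p, ∀ v ∈ N, F p v ∈ N) (hH : ∀ p, ∀ v ∈ N, H p v ∈ N) (x : A ⊗[ℂ] Sl2) {v : M}
    (hv : v ∈ N) : ⁅x, v⁆ ∈ N := by
  refine lie_mem_of_currentEnd_mem (fun y p v hv => ?_) x hv
  obtain ⟨c₁, c₂, c₃, rfl⟩ := exists_eq_smul_add y
  simp only [map_add, map_smul, LinearMap.add_apply, LinearMap.smul_apply]
  exact N.add_mem (N.add_mem (N.smul_mem _ (hE p v hv)) (N.smul_mem _ (hF p v hv)))
    (N.smul_mem _ (hH p v hv))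

variable (A) in
/-- The subspace obtained from `B` by applying the lowering operators `p ⊗ f`. -/
def lowerSpan (B : Submodule ℂ M) : Submodule ℂ M :=
  sInf {N | B ≤ N ∧ ∀ p : A, ∀ v ∈ N, F p v ∈ N}

section LowerSpan

variable {B N : Submodule ℂ M}

theorem le_lowerSpan : B ≤ lowerSpan A B := le_sInf fun _ hN => hN.1

theorem lowerSpan_le (hBN : B ≤ N) (hF : ∀ p : A, ∀ v ∈ N, F p v ∈ N) : lowerSpan A B ≤ N :=
  sInf_le ⟨hBN, hF⟩

theorem F_mem_lowerSpan (p : A) {v : M} (hv : v ∈ lowerSpan A B) : F p v ∈ lowerSpan A B :=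
  Submodule.mem_sInf.mpr fun N hN => hN.2 p v (Submodule.mem_sInf.mp hv N hN)

theorem mem_lowerSpan_of_lie {g : End ℂ M} (hgB : ∀ v ∈ B, g v ∈ lowerSpan A B)
    (hgF : ∀ q : A, ∀ v ∈ lowerSpan A B, ⁅g, F q⁆ v ∈ lowerSpan A B) :
    ∀ v ∈ lowerSpan A B, g v ∈ lowerSpan A B := by
  suffices lowerSpan A B ≤ lowerSpan A B ⊓ (lowerSpan A B).comap g from fun v hv => (this hv).2
  refine lowerSpan_le (le_inf le_lowerSpan hgB) fun q v hv => ⟨F_mem_lowerSpan q hv.1, ?_⟩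
  have hcomm : g (F q v) = ⁅g, F q⁆ v + F q (g v) := (sub_add_cancel _ _).symm
  rw [SetLike.mem_coe, Submodule.mem_comap, hcomm]
  exact add_mem (hgF q v hv.1) (F_mem_lowerSpan q hv.2)

end LowerSpan

variable (A) in
/-- A space of singular vectors of weight `μ`: vectors killed by every `p ⊗ e` on which `1 ⊗ h` acts
as `μ`. The space, not each vector, is stable under the commuting operators `p ⊗ h`. -/
structure IsSingularSpace (B : Submodule ℂ M) (μ : ℂ) : Prop where
  E_apply (p : A) {v : M} (hv : v ∈ B) : E p v = 0
  H_mem (p : A) {v : M} (hv : v ∈ B) : H p v ∈ B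
  H_one_apply {v : M} (hv : v ∈ B) : H 1 v = μ • v

namespace IsSingularSpace

variable {B : Submodule ℂ M} {μ : ℂ} (hB : IsSingularSpace A B μ)
include hB

theorem lieSpan_le_lowerSpan :
    (LieSubmodule.lieSpan ℂ (A ⊗[ℂ] Sl2) (B : Set M)).toSubmodule ≤ lowerSpan A B := by
  have hH (p : A) : ∀ v ∈ lowerSpan A B, H p v ∈ lowerSpan A B :=
    mem_lowerSpan_of_lie (fun v hv => le_lowerSpan (hB.H_mem p hv)) fun q v hv => by
      rw [lie_H_F]
      exact Submodule.smul_mem _ _ (F_mem_lowerSpan _ hv)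
  have hE (p : A) : ∀ v ∈ lowerSpan A B, E p v ∈ lowerSpan A B :=
    mem_lowerSpan_of_lie (fun v hv => by simp [hB.E_apply p hv]) fun q v hv => by
      rw [lie_E_F]
      exact hH _ v hv
  let N : LieSubmodule ℂ (A ⊗[ℂ] Sl2) M :=
    { lowerSpan A B with
      lie_mem := fun hv => lie_mem_of_stable hE (fun p v => F_mem_lowerSpan p) hH _ hv }
  have hspan : LieSubmodule.lieSpan ℂ (A ⊗[ℂ] Sl2) (B : Set M) ≤ N :=
    LieSubmodule.lieSpan_le.mpr le_lowerSpan
  exact hspan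

theorem lieSpan_le_sup_iSup_eigenspace :
    (LieSubmodule.lieSpan ℂ (A ⊗[ℂ] Sl2) (B : Set M)).toSubmodule ≤
      B ⊔ ⨆ n : ℕ, (H 1).eigenspace (μ - 2 * (n + 1)) := by
  refine hB.lieSpan_le_lowerSpan.trans (lowerSpan_le le_sup_left fun p v hv => ?_)
  suffices B ⊔ ⨆ n : ℕ, (H 1).eigenspace (μ - 2 * (n + 1)) ≤
      (⨆ n : ℕ, (H 1).eigenspace (μ - 2 * (n + 1))).comap (F p) from
    Submodule.mem_sup_right (this hv)
  refine sup_le (fun w hw => ?_) (iSup_le fun n w hw => ?_)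
  · refine Submodule.mem_iSup_of_mem 0 (End.mem_eigenspace_iff.mpr ?_)
    simpa using H_one_F_apply (hB.H_one_apply hw) p
  · refine Submodule.mem_iSup_of_mem (n + 1) (End.mem_eigenspace_iff.mpr ?_)
    rw [H_one_F_apply (End.mem_eigenspace_iff.mp hw)]
    push_cast
    ring_nf

theorem mem_of_H_one_apply {v : M} (hv : v ∈ LieSubmodule.lieSpan ℂ (A ⊗[ℂ] Sl2) (B : Set M))
    (hvμ : H 1 v = μ • v) : v ∈ B := by
  obtain ⟨b, hb, w, hw, rfl⟩ := Submodule.mem_sup.mp (hB.lieSpan_le_sup_iSup_eigenspace hv)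
  have hwμ : w ∈ (H 1).eigenspace μ := by
    rw [End.mem_eigenspace_iff]
    rwa [map_add, hB.H_one_apply hb, smul_add, add_right_inj] at hvμ
  have hlower : ⨆ n : ℕ, (H 1).eigenspace (μ - 2 * (n + 1)) ≤ ⨆ ν ≠ μ, (H 1).eigenspace ν :=
    iSup_le fun n => le_iSup₂_of_le (μ - 2 * (n + 1))
      (by simpa using Nat.cast_add_one_ne_zero n) le_rfl
  have hw0 : w = 0 :=
    Submodule.disjoint_def.mp ((H 1).eigenspaces_iSupIndep μ) w hwμ (hlower hw)
  rwa [hw0, add_zero]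

theorem eq_zero_of_H_one_apply {v : M}
    (hv : v ∈ LieSubmodule.lieSpan ℂ (A ⊗[ℂ] Sl2) (B : Set M)) {n : ℕ} (hn : n ≠ 0)
    (hvμ : H 1 v = (μ + 2 * n) • v) : v = 0 := by
  have hupper (k : ℕ) : μ - 2 * k ≠ μ + 2 * n := fun hk => by
    have : ((k + n : ℕ) : ℂ) = 0 := by
      push_cast
      linear_combination -hk / 2
    exact hn (Nat.add_eq_zero_iff.mp (Nat.cast_eq_zero.mp this)).2
  have hle : B ⊔ ⨆ k : ℕ, (H 1).eigenspace (μ - 2 * (k + 1)) ≤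
      ⨆ ν ≠ μ + 2 * n, (H 1).eigenspace ν := by
    refine sup_le (fun b hb => ?_) (iSup_le fun k => ?_)
    · refine Submodule.mem_iSup_of_mem μ (Submodule.mem_iSup_of_mem (by simpa using hn) ?_)
      exact End.mem_eigenspace_iff.mpr (hB.H_one_apply hb)
    · exact le_iSup₂_of_le _ (by simpa using hupper (k + 1)) le_rfl
  exact Submodule.disjoint_def.mp ((H 1).eigenspaces_iSupIndep (μ + 2 * n)) v
    (End.mem_eigenspace_iff.mpr hvμ) (hle (hB.lieSpan_le_sup_iSup_eigenspace hv))

end IsSingularSpace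

theorem exists_singularVector_mem [FiniteDimensional ℂ M] {N : LieSubmodule ℂ (A ⊗[ℂ] Sl2) M}
    (hN : N ≠ ⊥) : ∃ v ∈ N, v ≠ 0 ∧ ∀ p, E p v = 0 := by
  have : Nontrivial N := (LieSubmodule.nontrivial_iff_ne_bot ℂ (A ⊗[ℂ] Sl2) M).mpr hN
  obtain ⟨μ₀, hμ₀⟩ := End.exists_eigenvalue (currentEnd A N h 1)
  obtain ⟨μ, hμ, hμ'⟩ := exists_hasEigenvalue_not_hasEigenvalue_add hμ₀ two_ne_zero
  obtain ⟨v, hv, hv0⟩ := hμ.exists_hasEigenvector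
  rw [End.mem_eigenspace_iff] at hv
  refine ⟨v, v.property, by simpa using hv0, fun p => ?_⟩
  have hEv : currentEnd A N e p v = 0 := of_not_not fun hne => hμ' <|
    End.hasEigenvalue_of_hasEigenvector ⟨End.mem_eigenspace_iff.mpr (H_one_E_apply hv p), hne⟩
  exact congrArg Subtype.val hEv

/-- `Ω` is a highest weight vector that generates `M`: it is killed by every `p ⊗ e`, and `p ⊗ h`
acts on it as the scalar `D p`. -/
structure IsHighestWeightGenerator (Ω : M) (D : A →ₗ[ℂ] ℂ) : Prop where
  ne_zero : Ω ≠ 0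
  E_apply (p : A) : E p Ω = 0
  H_apply (p : A) : H p Ω = D p • Ω
  lieSpan_eq_top : LieSubmodule.lieSpan ℂ (A ⊗[ℂ] Sl2) {Ω} = ⊤

namespace IsHighestWeightGenerator

variable {Ω : M} {D : A →ₗ[ℂ] ℂ} (hΩ : IsHighestWeightGenerator Ω D)
include hΩ

theorem eq_top_of_mem {N : LieSubmodule ℂ (A ⊗[ℂ] Sl2) M} (hN : Ω ∈ N) : N = ⊤ := by
  rw [eq_top_iff, ← hΩ.lieSpan_eq_top]
  exact LieSubmodule.lieSpan_le.mpr (Set.singleton_subset_iff.mpr hN)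

theorem mem_of_currentEnd_mem {N : Submodule ℂ M}
    (hN : ∀ y p, ∀ v ∈ N, currentEnd A M y p v ∈ N) (hΩN : Ω ∈ N) (v : M) : v ∈ N := by
  let N' : LieSubmodule ℂ (A ⊗[ℂ] Sl2) M :=
    { N with lie_mem := lie_mem_of_currentEnd_mem hN _ }
  have hv : v ∈ (⊤ : LieSubmodule ℂ (A ⊗[ℂ] Sl2) M) := trivial
  rwa [← hΩ.eq_top_of_mem (N := N') hΩN] at hv

theorem isSingularSpace_span : IsSingularSpace A (ℂ ∙ Ω) (D 1) where
  E_apply p v hv := by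
    obtain ⟨c, rfl⟩ := Submodule.mem_span_singleton.mp hv
    rw [map_smul, hΩ.E_apply, smul_zero]
  H_mem p v hv := by
    obtain ⟨c, rfl⟩ := Submodule.mem_span_singleton.mp hv
    rw [map_smul, hΩ.H_apply]
    exact Submodule.smul_mem _ _ (Submodule.smul_mem _ _ (Submodule.mem_span_singleton_self Ω))
  H_one_apply {v} hv := by
    obtain ⟨c, rfl⟩ := Submodule.mem_span_singleton.mp hv
    rw [map_smul, hΩ.H_apply, smul_comm]

theorem mem_lieSpan_span (v : M) :
    v ∈ LieSubmodule.lieSpan ℂ (A ⊗[ℂ] Sl2) ((ℂ ∙ Ω : Submodule ℂ M) : Set M) := by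
  rw [hΩ.eq_top_of_mem (LieSubmodule.subset_lieSpan (Submodule.mem_span_singleton_self Ω))]
  exact LieSubmodule.mem_top v

theorem mem_span_of_H_one_apply {v : M} (hv : H 1 v = D 1 • v) : v ∈ ℂ ∙ Ω :=
  hΩ.isSingularSpace_span.mem_of_H_one_apply (hΩ.mem_lieSpan_span v) hv

theorem eq_zero_of_H_one_apply {v : M} {n : ℕ} (hn : n ≠ 0) (hv : H 1 v = (D 1 + 2 * n) • v) :
    v = 0 :=
  hΩ.isSingularSpace_span.eq_zero_of_H_one_apply (hΩ.mem_lieSpan_span v) hn hv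

theorem E_F_apply (p q : A) : E p (F q Ω) = D (p * q) • Ω := by
  rw [Sl2Loop.E_F_apply, hΩ.E_apply, map_zero, zero_add, hΩ.H_apply]

theorem E_pow_F_pow_eq_zero (p q : A) {m n : ℕ} (hmn : n < m) :
    (E p ^ m) ((F q ^ n) Ω) = 0 := by
  have hE : ⁅H 1, E p⁆ = (2 : ℂ) • E p := by rw [lie_H_E, one_mul]
  have hF : ⁅H 1, F q⁆ = (-2 : ℂ) • F q := by rw [lie_H_F, one_mul]
  refine hΩ.eq_zero_of_H_one_apply (Nat.sub_ne_zero_of_lt hmn) ?_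
  rw [apply_pow_apply_of_lie_eq_smul hE (apply_pow_apply_of_lie_eq_smul hF (hΩ.H_apply 1) n) m,
    Nat.cast_sub hmn.le]
  congr 1
  ring

theorem F_mul_apply_eq_zero {p : A} (hp : F p Ω = 0) (g : A) : F (g * p) Ω = 0 := by
  have hcomm := H_F_apply g p Ω
  rw [hΩ.H_apply, map_smul, hp, map_zero, smul_zero, zero_add] at hcomm
  exact (smul_eq_zero.mp hcomm.symm).resolve_left (by norm_num)

/-- The ideal of those `p` for which `p ⊗ f` kills the highest weight vector. -/
def annihilator : Ideal A where
  carrier := {p | F p Ω = 0}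
  zero_mem' := by simp
  add_mem' {p q} hp hq := by
    rw [Set.mem_ofPred_eq] at hp hq ⊢
    rw [map_add, LinearMap.add_apply, hp, hq, add_zero]
  smul_mem' g p hp := hΩ.F_mul_apply_eq_zero hp g

theorem mem_annihilator {p : A} : p ∈ hΩ.annihilator ↔ F p Ω = 0 := Iff.rfl

theorem apply_eq_zero_of_mem_annihilator {p : A} (hp : p ∈ hΩ.annihilator) : D p = 0 := by
  have hDp := hΩ.E_F_apply 1 p
  rw [hΩ.mem_annihilator.mp hp, map_zero, one_mul] at hDp
  exact (smul_eq_zero.mp hDp.symm).resolve_right hΩ.ne_zero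

theorem currentEnd_eq_zero {p : A} (hp : p ∈ hΩ.annihilator) (y : Sl2) :
    currentEnd A M y p = 0 := by
  let N : Submodule ℂ M := ⨅ y, ⨅ q ∈ hΩ.annihilator, LinearMap.ker (currentEnd A M y q)
  have hN {v : M} : v ∈ N ↔ ∀ y, ∀ q ∈ hΩ.annihilator, currentEnd A M y q v = 0 := by
    simp only [N, Submodule.mem_iInf, LinearMap.mem_ker]
  ext v
  refine hN.mp (hΩ.mem_of_currentEnd_mem (fun z g w hw => hN.mpr fun y q hq => ?_)
    (hN.mpr fun y q hq => ?_) v) y p hp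
  · have hcomm : currentEnd A M y q (currentEnd A M z g w) =
        currentEnd A M ⁅y, z⁆ (q * g) w + currentEnd A M z g (currentEnd A M y q w) :=
      sub_eq_iff_eq_add.mp (LinearMap.congr_fun (lie_currentEnd y z q g) w)
    rw [hcomm, hN.mp hw y q hq, hN.mp hw _ _ (Ideal.mul_mem_right g _ hq), map_zero, add_zero]
  · obtain ⟨c₁, c₂, c₃, rfl⟩ := exists_eq_smul_add y
    simp only [map_add, map_smul, LinearMap.add_apply, LinearMap.smul_apply, hΩ.E_apply,
      hΩ.mem_annihilator.mp hq, hΩ.H_apply, hΩ.apply_eq_zero_of_mem_annihilator hq, zero_smul,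
      smul_zero, add_zero]

theorem currentEnd_congr {p q : A} (hpq : p - q ∈ hΩ.annihilator) (y : Sl2) :
    currentEnd A M y p = currentEnd A M y q := by
  rw [← sub_eq_zero, ← map_sub, hΩ.currentEnd_eq_zero hpq]

theorem apply_congr {p q : A} (hpq : p - q ∈ hΩ.annihilator) : D p = D q := by
  rw [← sub_eq_zero, ← map_sub, hΩ.apply_eq_zero_of_mem_annihilator hpq]

theorem finite_quotient_annihilator [FiniteDimensional ℂ M] :
    FiniteDimensional ℂ (A ⧸ hΩ.annihilator) := by
  let φ : A →ₗ[ℂ] M := (currentEnd A M f).flip Ω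
  have hker : hΩ.annihilator.restrictScalars ℂ = LinearMap.ker φ := rfl
  have : FiniteDimensional ℂ (A ⧸ hΩ.annihilator.restrictScalars ℂ) :=
    hker ▸ Module.Finite.equiv φ.quotKerEquivRange.symm
  exact Module.Finite.equiv (Submodule.Quotient.restrictScalarsEquiv ℂ hΩ.annihilator)

theorem le_annihilator_of_isIrreducible (hirr : LieModule.IsIrreducible ℂ (A ⊗[ℂ] Sl2) M)
    {J : Ideal A} (hJ : ∀ p ∈ J, D p = 0) : J ≤ hΩ.annihilator := by
  let B : Submodule ℂ M := (J.restrictScalars ℂ).map ((currentEnd A M f).flip Ω)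
  have hB : IsSingularSpace A B (D 1 - 2) := by
    refine ⟨?_, ?_, ?_⟩
    · rintro q _ ⟨p, hp, rfl⟩
      rw [LinearMap.flip_apply, hΩ.E_F_apply, hJ _ (J.mul_mem_left q hp), zero_smul]
    · rintro q _ ⟨p, hp, rfl⟩
      rw [LinearMap.flip_apply, H_F_apply, hΩ.H_apply, map_smul]
      exact B.add_mem (B.smul_mem _ ⟨p, hp, rfl⟩)
        (B.smul_mem _ ⟨q * p, J.mul_mem_left q hp, rfl⟩)
    · rintro _ ⟨p, -, rfl⟩
      exact H_one_F_apply (hΩ.H_apply 1) p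
  intro p hp
  by_contra hne
  have hspan : LieSubmodule.lieSpan ℂ (A ⊗[ℂ] Sl2) (B : Set M) = ⊤ := by
    refine (eq_bot_or_eq_top _).resolve_left fun hbot => hne ?_
    have hmem : F p Ω ∈ LieSubmodule.lieSpan ℂ (A ⊗[ℂ] Sl2) (B : Set M) :=
      LieSubmodule.subset_lieSpan ⟨p, hp, rfl⟩
    rwa [hbot, LieSubmodule.mem_bot] at hmem
  refine hΩ.ne_zero (hB.eq_zero_of_H_one_apply (hspan ▸ LieSubmodule.mem_top Ω) one_ne_zero ?_)
  rw [hΩ.H_apply, Nat.cast_one, mul_one, sub_add_cancel]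

theorem E_F_pow_succ_apply {p : A} (hp : p * p ∈ hΩ.annihilator) (n : ℕ) :
    E 1 ((F p ^ (n + 1)) Ω) = ((n + 1) * D p) • (F p ^ n) Ω := by
  have hlie : ⁅H p, F p⁆ = (0 : ℂ) • F p := by
    rw [lie_H_F, hΩ.currentEnd_eq_zero hp, smul_zero, zero_smul]
  have hH (k : ℕ) : H p ((F p ^ k) Ω) = D p • (F p ^ k) Ω := by
    simpa using apply_pow_apply_of_lie_eq_smul hlie (hΩ.H_apply p) k
  induction n with
  | zero => simp [hΩ.E_F_apply]
  | succ n ih =>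
    rw [pow_succ', End.mul_apply, Sl2Loop.E_F_apply, ih, map_smul, one_mul, hH, ← End.mul_apply,
      ← pow_succ', ← add_smul]
    push_cast
    ring_nf

theorem apply_eq_zero_of_mul_self_mem [FiniteDimensional ℂ M] {p : A}
    (hp : p * p ∈ hΩ.annihilator) : D p = 0 := by
  have hF : ⁅H 1, F p⁆ = (-2 : ℂ) • F p := by rw [lie_H_F, one_mul]
  obtain ⟨n, hn, hn'⟩ := Nat.exists_not_and_succ_of_not_zero_of_exists hΩ.ne_zero
    (exists_pow_apply_eq_zero_of_lie_eq_smul (by norm_num) hF (hΩ.H_apply 1))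
  have hzero := hΩ.E_F_pow_succ_apply hp n
  rw [hn', map_zero, eq_comm, smul_eq_zero, or_iff_left hn, mul_eq_zero] at hzero
  exact hzero.resolve_left (Nat.cast_add_one_ne_zero n)

theorem isRadical_annihilator_of_isIrreducible [FiniteDimensional ℂ M]
    (hirr : LieModule.IsIrreducible ℂ (A ⊗[ℂ] Sl2) M) : hΩ.annihilator.IsRadical := by
  refine (Ideal.isRadical_iff_pow_one_lt 2 one_lt_two).mpr fun p hp => ?_
  refine hΩ.le_annihilator_of_isIrreducible hirr (J := Ideal.span {p}) (fun g hg => ?_)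
    (Ideal.mem_span_singleton_self p)
  obtain ⟨c, rfl⟩ := Ideal.mem_span_singleton.mp hg
  refine hΩ.apply_eq_zero_of_mul_self_mem ?_
  rw [← sq, mul_pow]
  exact Ideal.mul_mem_right _ _ hp

section Idempotent

variable {l : A} {φ : A →ₐ[ℂ] ℂ} (hl : IsPrimitiveIdempotentMod hΩ.annihilator l φ)
include hl

theorem currentEnd_mul_idempotent (y : Sl2) (g : A) :
    currentEnd A M y (g * l) = φ g • currentEnd A M y l := by
  rw [hΩ.currentEnd_congr (hl.mul_sub_smul_mem g), map_smul]

theorem isSl2Triple_idempotent : IsSl2Triple (H l) (E l) (F l) := by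
  have hll (y : Sl2) : currentEnd A M y (l * l) = currentEnd A M y l := by
    rw [hΩ.currentEnd_mul_idempotent hl, hl.apply_self, one_smul]
  have hHF : ⁅H l, F l⁆ = -(2 • F l) := by
    rw [lie_H_F, hll, neg_smul, two_smul, two_smul]
  refine ⟨fun h0 => hl.notMem (hΩ.mem_annihilator.mpr ?_), by rw [lie_E_F, hll], ?_, hHF⟩
  · rw [h0, zero_lie, eq_comm, neg_eq_zero, two_smul, ← two_smul ℂ] at hHF
    rw [(smul_eq_zero.mp hHF).resolve_left two_ne_zero, LinearMap.zero_apply]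
  · rw [lie_H_E, hll, two_smul, two_smul]

theorem hasPrimitiveVectorWith_idempotent :
    (hΩ.isSl2Triple_idempotent hl).HasPrimitiveVectorWith Ω (D l) :=
  ⟨hΩ.ne_zero, hΩ.H_apply l, hΩ.E_apply l⟩

theorem exists_natCast_eq_idempotent [FiniteDimensional ℂ M] : ∃ n : ℕ, 0 < n ∧ D l = n := by
  have hprim := hΩ.hasPrimitiveVectorWith_idempotent hl
  obtain ⟨n, hn⟩ := hprim.exists_nat
  refine ⟨n, Nat.pos_of_ne_zero fun h0 => hl.notMem (hΩ.mem_annihilator.mpr ?_), hn⟩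
  simpa [h0, LieModule.toEnd_module_end] using hprim.pow_toEnd_f_eq_zero_of_eq_nat hn

theorem commute_currentEnd_casimir (y : Sl2) (g : A) :
    Commute (currentEnd A M y g) (casimir (H l) (E l) (F l)) := by
  have t := hΩ.isSl2Triple_idempotent hl
  have hyl : Commute (currentEnd A M y l) (casimir (H l) (E l) (F l)) := by
    obtain ⟨c₁, c₂, c₃, rfl⟩ := exists_eq_smul_add y
    simp only [map_add, map_smul, LinearMap.add_apply, LinearMap.smul_apply]
    exact (((commute_e_casimir t).smul_left c₁).add_left
      ((commute_f_casimir t).smul_left c₂)).add_left ((commute_h_casimir t).smul_left c₃)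
  have hcomm (z : Sl2) :
      Commute (currentEnd A M y g - φ g • currentEnd A M y l) (currentEnd A M z l) := by
    rw [commute_iff_lie_eq, sub_lie, smul_lie, lie_currentEnd, lie_currentEnd,
      hΩ.currentEnd_mul_idempotent hl, hΩ.currentEnd_mul_idempotent hl, hl.apply_self, one_smul,
      sub_self]
  simpa using (commute_casimir (hcomm h) (hcomm e) (hcomm f)).add_left (hyl.smul_left (φ g))

theorem casimir_idempotent_apply (v : M) :
    casimir (H l) (E l) (F l) v = (D l * (D l + 2)) • v := by
  let N := LinearMap.eqLocus (casimir (H l) (E l) (F l)) ((D l * (D l + 2)) • (1 : End ℂ M))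
  suffices v ∈ N from this
  refine hΩ.mem_of_currentEnd_mem (fun y g w hw => ?_) ?_ v
  · have hw' : casimir (H l) (E l) (F l) w = (D l * (D l + 2)) • w := hw
    rw [LinearMap.mem_eqLocus, ← End.mul_apply, ← (hΩ.commute_currentEnd_casimir hl y g).eq,
      End.mul_apply, hw', map_smul]
    rfl
  · rw [LinearMap.mem_eqLocus, casimir_apply (hΩ.E_apply l), hΩ.H_apply, map_smul, hΩ.H_apply,
      LinearMap.smul_apply, End.one_apply]
    module

theorem H_idempotent_apply_of_E_apply_eq_zero [FiniteDimensional ℂ M] {v : M}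
    (hv : ∀ p, E p v = 0) : H l v = D l • v := by
  obtain ⟨n, -, hn⟩ := hΩ.exists_natCast_eq_idempotent hl
  have hcas := hΩ.casimir_idempotent_apply hl v
  rw [casimir_apply (hv l)] at hcas
  -- The Casimir relation reads `(H l - n) (H l + n + 2) v = 0`, so `H l v - n v` would be a
  -- primitive vector of the negative weight `-(n + 2)`.
  have hEH : E l (H l v) = 0 := by
    have hcomm := H_E_apply l l v
    rw [hv, hv, map_zero, smul_zero, add_zero] at hcomm
    exact hcomm.symm
  have hw : H l (H l v - D l • v) = (-(n + 2) : ℂ) • (H l v - D l • v) := by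
    rw [map_sub, map_smul, eq_sub_of_add_eq hcas, hn]
    module
  by_contra hne
  obtain ⟨k, hk⟩ := IsSl2Triple.HasPrimitiveVectorWith.exists_nat
    (t := hΩ.isSl2Triple_idempotent hl) (m := H l v - D l • v)
    ⟨sub_ne_zero.mpr hne, hw, by simp [hEH, hv]⟩
  have : ((k + n + 2 : ℕ) : ℂ) = 0 := by
    push_cast
    linear_combination -hk
  exact absurd (Nat.cast_eq_zero.mp this) (by omega)

end Idempotent

theorem isIrreducible_of_isRadical_annihilator [FiniteDimensional ℂ M]
    (hI : hΩ.annihilator.IsRadical) : LieModule.IsIrreducible ℂ (A ⊗[ℂ] Sl2) M := by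
  have := hΩ.finite_quotient_annihilator
  have : Nontrivial M := ⟨Ω, 0, hΩ.ne_zero⟩
  obtain ⟨ι, _, l, φ, hl, -, hsum⟩ := exists_primitiveIdempotents_of_isRadical (k := ℂ) hI
  have hone : 1 - ∑ i, l i ∈ hΩ.annihilator := by simpa using hsum 1
  refine LieModule.IsIrreducible.mk fun N hN => hΩ.eq_top_of_mem ?_
  obtain ⟨v, hvN, hv0, hvE⟩ := exists_singularVector_mem hN
  have hH : H 1 v = D 1 • v := by
    rw [hΩ.currentEnd_congr hone, hΩ.apply_congr hone, map_sum, map_sum, LinearMap.sum_apply,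
      Finset.sum_smul]
    exact Finset.sum_congr rfl fun i _ => hΩ.H_idempotent_apply_of_E_apply_eq_zero (hl i) hvE
  obtain ⟨c, rfl⟩ := Submodule.mem_span_singleton.mp (hΩ.mem_span_of_H_one_apply hH)
  exact (Submodule.smul_mem_iff N.toSubmodule (left_ne_zero_of_smul hv0)).mp hvN

end IsHighestWeightGenerator

open Polynomial

theorem coeff_one_sub_C_mul_X_pow {R : Type*} [CommRing R] (b : R) (n j : ℕ) :
    ((1 - C b * X) ^ n).coeff j = (-b) ^ j * n.choose j := by
  have hcomp : (1 - C b * X) ^ n = ((1 + X) ^ n).comp (C (-b) * X) := by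
    simp [sub_eq_add_neg]
  rw [hcomp, comp_C_mul_X_coeff, coeff_one_add_X_pow, mul_comm]

/-- The polynomial `P` has the coefficient `(-1)ʲ λⱼ` at `uʲ`, where `λⱼ` is the eigenvalue of
`(p ⊗ e)^(j) (q ⊗ f)^(j)` on `Ω`. For the loop algebra with `p = 1` and `q = t` it is the Drinfeld
polynomial. -/
def IsDrinfeldPolynomial (Ω : M) (p q : A) (P : ℂ[X]) : Prop :=
  ∀ j, dividedPower ℂ (E p) j (dividedPower ℂ (F q) j Ω) = ((-1) ^ j * P.coeff j) • Ω

namespace IsHighestWeightGenerator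

variable {Ω : M} {D : A →ₗ[ℂ] ℂ} {l : A} {φ : A →ₐ[ℂ] ℂ} (hΩ : IsHighestWeightGenerator Ω D)

theorem isDrinfeldPolynomial_idempotent (hl : IsPrimitiveIdempotentMod hΩ.annihilator l φ) {n : ℕ}
    (hn : D l = n) (b : ℂ) : IsDrinfeldPolynomial Ω l (b • l) ((1 - C b * X) ^ n) := by
  intro j
  have hprim := hΩ.hasPrimitiveVectorWith_idempotent hl
  rw [hn] at hprim
  have hj := dividedPower_e_dividedPower_f hprim j
  rw [LieModule.toEnd_module_end] at hj
  rw [map_smul, dividedPower_smul, LinearMap.smul_apply, map_smul, coeff_one_sub_C_mul_X_pow,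
    neg_pow b, mul_assoc, ← mul_assoc, ← mul_pow, neg_one_mul, neg_neg, one_pow, one_mul, mul_smul]
  exact congrArg _ hj

theorem commute_E_F_of_mul_mem {p q : A} (hpq : p * q ∈ hΩ.annihilator) : Commute (E p) (F q) := by
  rw [commute_iff_lie_eq, lie_E_F, hΩ.currentEnd_eq_zero hpq]

include hΩ in
theorem dividedPower_E_dividedPower_F_eq_zero (p q : A) {m n : ℕ} (hmn : n < m) :
    dividedPower ℂ (E p) m (dividedPower ℂ (F q) n Ω) = 0 := by
  rw [dividedPower, dividedPower, LinearMap.smul_apply, LinearMap.smul_apply, map_smul,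
    hΩ.E_pow_F_pow_eq_zero p q hmn, smul_zero, smul_zero]

theorem dividedPower_mul_apply_of_mul_mem {p q p' q' : A} {P P' : ℂ[X]}
    (hP : IsDrinfeldPolynomial Ω p q P) (hP' : IsDrinfeldPolynomial Ω p' q' P')
    (hpq' : p * q' ∈ hΩ.annihilator) (hp'q : p' * q ∈ hΩ.annihilator) {a b c d : ℕ}
    (habcd : a + b = c + d) :
    (dividedPower ℂ (E p) a * dividedPower ℂ (E p') b)
        ((dividedPower ℂ (F q) c * dividedPower ℂ (F q') d) Ω) =
      if (a, b) = (c, d) then ((-1) ^ (a + b) * (P.coeff a * P'.coeff b)) • Ω else 0 := by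
  have hEF := commute_dividedPower (K := ℂ) (hΩ.commute_E_F_of_mul_mem hpq') a d
  have hEF' := commute_dividedPower (K := ℂ) (hΩ.commute_E_F_of_mul_mem hp'q) b c
  have hEE := commute_dividedPower (K := ℂ) (commute_currentEnd (M := M) e p p') a b
  have hFF := commute_dividedPower (K := ℂ) (commute_currentEnd (M := M) f q q') c d
  rcases lt_trichotomy b d with hbd | rfl | hbd
  · rw [if_neg (by simp [hbd.ne]), hEE.eq, hFF.eq, ← End.mul_apply, hEF.mul_mul_mul_comm,
      End.mul_apply, End.mul_apply (dividedPower ℂ (E p) a),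
      hΩ.dividedPower_E_dividedPower_F_eq_zero p q (by omega), map_zero]
  · obtain rfl : a = c := by omega
    rw [if_pos rfl, ← End.mul_apply, hEF'.mul_mul_mul_comm, End.mul_apply,
      End.mul_apply (dividedPower ℂ (E p') b), hP' b, map_smul, End.mul_apply, hP a, smul_smul]
    congr 1
    ring
  · rw [if_neg (by simp [hbd.ne']), ← End.mul_apply, hEF'.mul_mul_mul_comm, End.mul_apply,
      End.mul_apply (dividedPower ℂ (E p') b),
      hΩ.dividedPower_E_dividedPower_F_eq_zero p' q' hbd, map_zero]

theorem isDrinfeldPolynomial_mul {p q p' q' : A} {P P' : ℂ[X]}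
    (hP : IsDrinfeldPolynomial Ω p q P) (hP' : IsDrinfeldPolynomial Ω p' q' P')
    (hpq' : p * q' ∈ hΩ.annihilator) (hp'q : p' * q ∈ hΩ.annihilator) :
    IsDrinfeldPolynomial Ω (p + p') (q + q') (P * P') := by
  intro j
  rw [map_add, map_add, dividedPower_add (commute_currentEnd e p p'),
    dividedPower_add (commute_currentEnd f q q'), LinearMap.sum_apply, LinearMap.sum_apply,
    coeff_mul, Finset.mul_sum, Finset.sum_smul]
  refine Finset.sum_congr rfl fun ab hab => ?_
  have hsum {cd : ℕ × ℕ} (hcd : cd ∈ Finset.HasAntidiagonal.antidiagonal j) :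
      ab.1 + ab.2 = cd.1 + cd.2 := by
    rw [Finset.HasAntidiagonal.mem_antidiagonal.mp hab,
      Finset.HasAntidiagonal.mem_antidiagonal.mp hcd]
  rw [map_sum, Finset.sum_congr rfl fun cd hcd =>
    hΩ.dividedPower_mul_apply_of_mul_mem hP hP' hpq' hp'q (hsum hcd)]
  simp only [Prod.mk.eta, Finset.sum_ite_eq, if_pos hab,
    Finset.HasAntidiagonal.mem_antidiagonal.mp hab]

theorem isDrinfeldPolynomial_sum_idempotent {ι : Type*} {l : ι → A} {φ : ι → A →ₐ[ℂ] ℂ}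
    (hl : ∀ i, IsPrimitiveIdempotentMod hΩ.annihilator (l i) (φ i))
    (horth : ∀ i j, i ≠ j → l i * l j ∈ hΩ.annihilator) {n : ι → ℕ} (hn : ∀ i, D (l i) = n i)
    (b : ι → ℂ) (S : Finset ι) :
    IsDrinfeldPolynomial Ω (∑ i ∈ S, l i) (∑ i ∈ S, b i • l i)
      (∏ i ∈ S, (1 - C (b i) * X) ^ n i) := by
  classical
  induction S using Finset.induction_on with
  | empty =>
    intro j
    cases j <;> simp [dividedPower, coeff_one]
  | insert i S hi ih =>
    have hne {k : ι} (hk : k ∈ S) : i ≠ k := fun h => hi (h ▸ hk)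
    rw [Finset.sum_insert hi, Finset.sum_insert hi, Finset.prod_insert hi]
    refine hΩ.isDrinfeldPolynomial_mul (hΩ.isDrinfeldPolynomial_idempotent (hl i) (hn i) (b i)) ih
      ?_ ?_
    · rw [Finset.mul_sum]
      refine sum_mem fun k hk => ?_
      rw [mul_smul_comm]
      exact Submodule.smul_of_tower_mem _ (b k) (horth i k (hne hk))
    · rw [mul_smul_comm, Finset.sum_mul]
      exact Submodule.smul_of_tower_mem _ (b i) (sum_mem fun k hk => horth k i (hne hk).symm)

include hΩ in
theorem exists_isDrinfeldPolynomial_of_isRadical_annihilator [FiniteDimensional ℂ M]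
    (hI : hΩ.annihilator.IsRadical) :
    ∃ (ι : Type u) (_ : Fintype ι) (φ : ι → A →ₐ[ℂ] ℂ) (n : ι → ℕ),
      (∀ p, (∀ i, φ i p = 0) → p ∈ hΩ.annihilator) ∧ (∀ i, 0 < n i) ∧
        D 1 = (∑ i, n i : ℕ) ∧
          ∀ q, IsDrinfeldPolynomial Ω 1 q (∏ i, (1 - C (φ i q) * X) ^ n i) := by
  have := hΩ.finite_quotient_annihilator
  obtain ⟨ι, hι, l, φ, hl, horth, hsum⟩ := exists_primitiveIdempotents_of_isRadical (k := ℂ) hI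
  have hone : 1 - ∑ i, l i ∈ hΩ.annihilator := by simpa using hsum 1
  choose n hn hDn using fun i => hΩ.exists_natCast_eq_idempotent (hl i)
  refine ⟨ι, hι, φ, n, fun p hp => by simpa [hp] using hsum p, hn, ?_, fun q => ?_⟩
  · rw [hΩ.apply_congr hone, map_sum, Nat.cast_sum]
    exact Finset.sum_congr rfl fun i _ => hDn i
  · intro j
    rw [hΩ.currentEnd_congr hone, hΩ.currentEnd_congr (hsum q)]
    exact hΩ.isDrinfeldPolynomial_sum_idempotent hl horth hDn (fun i => φ i q) Finset.univ j

end IsHighestWeightGenerator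

end CurrentModule

section Laurent

open Polynomial
open LaurentPolynomial hiding C smul_eq_C_mul

theorem isRadical_of_isRadical_comap {R S : Type*} [CommRing R] [CommRing S] [Algebra R S]
    (W : Submonoid R) [IsLocalization W S] {I : Ideal S}
    (hI : (I.comap (algebraMap R S)).IsRadical) : I.IsRadical := by
  rw [← Ideal.radical_eq_iff] at hI ⊢
  rw [← IsLocalization.map_under W S I, ← IsLocalization.map_radical W, hI]

theorem isRadical_of_squarefree_mem {R : Type*} [CommRing R] [IsPrincipalIdealRing R] [IsDomain R]
    {I : Ideal R} {x : R} (hx : Squarefree x) (hxI : x ∈ I) : I.IsRadical := by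
  obtain ⟨g, rfl⟩ := IsPrincipalIdealRing.principal I
  rw [Ideal.submodule_span_eq] at hxI ⊢
  have hg : Squarefree g := hx.squarefree_of_dvd (Ideal.mem_span_singleton.mp hxI)
  exact isRadical_iff_span_singleton.mp hg.isRadical

theorem isRadical_of_prod_T_sub_C_mem {k ι : Type*} [Field k] [Fintype ι] {a : ι → k}
    (ha : Function.Injective a) {I : Ideal k[T;T⁻¹]}
    (hI : ∏ i, (T 1 - LaurentPolynomial.C (a i)) ∈ I) : I.IsRadical := by
  refine isRadical_of_isRadical_comap (Submonoid.powers (X : k[X])) ?_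
  refine isRadical_of_squarefree_mem (separable_prod_X_sub_C_iff.mpr ha).squarefree ?_
  rw [Ideal.mem_comap, map_prod]
  simpa [algebraMap_eq_toLaurent] using hI

theorem prod_X_sub_C_eq_sum {R : Type*} [CommRing R] {s : ℕ} (a : Fin s → R) :
    ∏ i, (X - C (a i)) = ∑ k ∈ Finset.range (s + 1), ((-1 : R) ^ k *
      ∑ I ∈ Finset.powersetCard k (Finset.univ : Finset (Fin s)), ∏ i ∈ I, a i) •
        (X : R[X]) ^ (s - k) := by
  have h := Multiset.prod_X_sub_X_eq_sum_esymm (Finset.univ.val.map a)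
  simp only [Multiset.map_map, Multiset.card_map, Finset.card_val, Finset.card_univ,
    Fintype.card_fin, Finset.esymm_map_val] at h
  refine h.trans (Finset.sum_congr rfl fun k _ => ?_)
  rw [smul_eq_C_mul, C_mul, C_pow, C_neg, C_1, mul_assoc]

theorem xMinusParam_eq_tmul {s : ℕ} (a : Fin s → ℂ) :
    xMinusParam a = (∏ i, (T 1 - LaurentPolynomial.C (a i))) ⊗ₜ[ℂ] f := by
  have hprod : ∏ i, (T 1 - LaurentPolynomial.C (a i)) = toLaurentAlg (∏ i, (X - C (a i))) := by
    simp
  rw [hprod, prod_X_sub_C_eq_sum, map_sum, TensorProduct.sum_tmul, xMinusParam]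
  refine Finset.sum_congr rfl fun k hk => ?_
  rw [map_smul, ← TensorProduct.smul_tmul', map_pow, toLaurentAlg_apply, toLaurent_X, T_pow,
    mul_one, Nat.cast_sub (Finset.mem_range_succ_iff.mp hk)]
  rfl

theorem algHom_T_ne_zero {k B : Type*} [CommSemiring k] [Semiring B] [Nontrivial B] [Algebra k B]
    (φ : k[T;T⁻¹] →ₐ[k] B) (n : ℤ) : φ (T n) ≠ 0 :=
  ((isUnit_T n).map φ).ne_zero

theorem exists_eq_of_prod_pow_eq_prod_pow {k ι κ : Type*} [Field k] [Fintype ι] [Fintype κ]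
    {b : ι → k} {n : ι → ℕ} {a : κ → k} {m : κ → ℕ}
    (h : ∏ i, (1 - C (b i) * X) ^ n i = ∏ j, (1 - C (a j) * X) ^ m j) {i : ι} (hb : b i ≠ 0)
    (hn : n i ≠ 0) : ∃ j, b i = a j := by
  have heval := congrArg (eval (b i)⁻¹) h
  rw [eval_prod, Finset.prod_eq_zero (Finset.mem_univ i) (by simp [hb, hn]), eq_comm, eval_prod,
    Finset.prod_eq_zero_iff] at heval
  obtain ⟨j, -, hj⟩ := heval
  have hj' : 1 - a j * (b i)⁻¹ = 0 := by simpa using eq_zero_of_pow_eq_zero (by simpa using hj)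
  refine ⟨j, ?_⟩
  rw [sub_eq_zero, eq_mul_inv_iff_mul_eq₀ hb, one_mul] at hj'
  exact hj'

theorem natDegree_prod_one_sub_C_mul_X_pow_le {R ι : Type*} [CommRing R] (S : Finset ι) (b : ι → R)
    (n : ι → ℕ) : (∏ i ∈ S, (1 - C (b i) * X) ^ n i).natDegree ≤ ∑ i ∈ S, n i := by
  refine (natDegree_prod_le _ _).trans (Finset.sum_le_sum fun i _ => ?_)
  have hlin : (1 - C (b i) * X).natDegree ≤ 1 := by compute_degree
  simpa using natDegree_pow_le_of_le (n i) hlin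

end Laurent

section GenRep

open Polynomial
open LaurentPolynomial hiding C smul_eq_C_mul

variable {V : Type*} [AddCommGroup V] [Module ℂ V] [LieRingModule LoopSl2 V]

/-- `Ω` as a vector of the representation it generates. -/
def genVector (Ω : V) : genRep Ω := ⟨Ω, LieSubmodule.subset_lieSpan rfl⟩

theorem lieSpan_genVector (Ω : V) : LieSubmodule.lieSpan ℂ LoopSl2 {genVector Ω} = ⊤ := by
  have hle : genRep Ω ≤
      (LieSubmodule.lieSpan ℂ LoopSl2 {genVector Ω}).map (genRep Ω).incl :=
    LieSubmodule.lieSpan_le.mpr <| Set.singleton_subset_iff.mpr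
      ((LieSubmodule.mem_map _).mpr ⟨genVector Ω, LieSubmodule.subset_lieSpan rfl, rfl⟩)
  refine eq_top_iff.mpr fun v _ => ?_
  obtain ⟨w, hw, hwv⟩ := (LieSubmodule.mem_map _).mp (hle v.2)
  rwa [← Subtype.ext (a1 := w) (a2 := v) hwv]

theorem weight_eq {Ω : V} (hΩ : Ω ≠ 0) {n : ℕ} (hn : ⁅hGen 0, Ω⁆ = (n : ℂ) • Ω) :
    weight Ω = n := by
  have hweight : ⁅hGen 0, Ω⁆ = (weight Ω : ℂ) • Ω :=
    Classical.epsilon_spec (p := fun r : ℕ => ⁅hGen 0, Ω⁆ = (r : ℂ) • Ω) ⟨n, hn⟩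
  exact_mod_cast smul_left_injective ℂ hΩ (hweight.symm.trans hn)

variable [LieModule ℂ LoopSl2 V]

theorem coe_dividedPower_apply (N : LieSubmodule ℂ LoopSl2 V) (y : LoopSl2) (n : ℕ) (v : N) :
    (dividedPower ℂ (LieModule.toEnd ℂ LoopSl2 N y) n v : V) = divPow y n (v : V) := by
  have hpow : ∀ k, (((LieModule.toEnd ℂ LoopSl2 N y ^ k) v : N) : V) =
      (LieModule.toEnd ℂ LoopSl2 V y ^ k) v := fun k => by
    induction k with
    | zero => rfl
    | succ k ih =>
      rw [pow_succ', pow_succ', End.mul_apply, End.mul_apply, ← ih]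
      rfl
  exact congrArg _ (hpow n)

theorem IsHighestWeightVector.exists_isHighestWeightGenerator {Ω : V}
    (hΩ : IsHighestWeightVector Ω) :
    ∃ D, IsHighestWeightGenerator (A := ℂ[T;T⁻¹]) (genVector Ω) D := by
  choose d hd using hΩ.hGen_lie
  let B : Basis ℤ ℂ ℂ[T;T⁻¹] := AddMonoidAlgebra.basis ℤ ℂ
  have hB (n : ℤ) : B n = T n := AddMonoidAlgebra.basis_apply ℂ n
  have hE : (currentEnd ℂ[T;T⁻¹] (genRep Ω) e).flip (genVector Ω) = 0 :=
    B.ext fun n => hB n ▸ Subtype.ext (hΩ.xPlus_lie n)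
  have hH : (currentEnd ℂ[T;T⁻¹] (genRep Ω) h).flip (genVector Ω) =
      (B.constr ℂ d).smulRight (genVector Ω) := B.ext fun n => by
    rw [LinearMap.smulRight_apply, B.constr_basis, hB]
    exact Subtype.ext (hd n)
  exact ⟨B.constr ℂ d, fun h0 => hΩ.ne_zero (congrArg Subtype.val h0), LinearMap.congr_fun hE,
    LinearMap.congr_fun hH, lieSpan_genVector Ω⟩

theorem eigenval_eq {Ω : V} (hΩ : Ω ≠ 0) {j : ℕ} {c : ℂ}
    (hc : divPow (xPlus 0) j (divPow (xMinus 1) j Ω) = c • Ω) : eigenval Ω j = c := by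
  have heigenval : divPow (xPlus 0) j (divPow (xMinus 1) j Ω) = eigenval Ω j • Ω :=
    Classical.epsilon_spec
      (p := fun c : ℂ => divPow (xPlus 0) j (divPow (xMinus 1) j Ω) = c • Ω) ⟨c, hc⟩
  exact smul_left_injective ℂ hΩ (heigenval.symm.trans hc)

theorem drinfeldPoly_eq {Ω : V} (hΩ : Ω ≠ 0) {n : ℕ} (hn : ⁅hGen 0, Ω⁆ = (n : ℂ) • Ω) {P : ℂ[X]}
    (hP : IsDrinfeldPolynomial (genVector Ω) (1 : ℂ[T;T⁻¹]) (T 1) P) (hdeg : P.natDegree ≤ n) :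
    drinfeldPoly Ω = P := by
  have heigenval (j : ℕ) : eigenval Ω j = (-1) ^ j * P.coeff j := by
    refine eigenval_eq hΩ (((coe_dividedPower_apply (genRep Ω) (xPlus 0) j _).trans
      (congrArg _ (coe_dividedPower_apply (genRep Ω) (xMinus 1) j (genVector Ω)))).symm.trans ?_)
    exact congrArg Subtype.val (hP j)
  rw [drinfeldPoly, weight_eq hΩ hn, P.as_sum_range_C_mul_X_pow' (Nat.lt_succ_of_le hdeg)]
  refine Finset.sum_congr rfl fun j _ => ?_
  have hsign : ((-1 : ℂ[X]) ^ j) * (-1) ^ j = 1 := by rw [← mul_pow, neg_one_mul, neg_neg, one_pow]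
  rw [heigenval, C_mul, C_pow, C_neg, C_1, neg_pow (X : ℂ[X])]
  linear_combination C (P.coeff j) * X ^ j * hsign

namespace IsHighestWeightGenerator

variable {Ω : V} {D : ℂ[T;T⁻¹] →ₗ[ℂ] ℂ} (hΩ : IsHighestWeightGenerator (genVector Ω) D)

theorem prod_T_sub_C_mem_annihilator_iff {s : ℕ} (a : Fin s → ℂ) :
    ∏ i, (T 1 - LaurentPolynomial.C (a i)) ∈ hΩ.annihilator ↔ ⁅xMinusParam a, Ω⁆ = 0 := by
  rw [xMinusParam_eq_tmul, hΩ.mem_annihilator, ← Subtype.coe_inj]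
  rfl

include hΩ in
theorem drinfeldPoly_eq_prod {ι : Type*} [Fintype ι] {b : ι → ℂ} {n : ι → ℕ}
    (hn : D 1 = (∑ i, n i : ℕ))
    (hP : IsDrinfeldPolynomial (genVector Ω) (1 : ℂ[T;T⁻¹]) (T 1) (∏ i, (1 - C (b i) * X) ^ n i)) :
    drinfeldPoly Ω = ∏ i, (1 - C (b i) * X) ^ n i := by
  refine drinfeldPoly_eq (fun h0 => hΩ.ne_zero (Subtype.ext h0)) ?_ hP
    (natDegree_prod_one_sub_C_mul_X_pow_le Finset.univ b n)
  exact hn ▸ congrArg Subtype.val (hΩ.H_apply 1)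

theorem prod_T_sub_C_mem_annihilator {s : ℕ} {a : Fin s → ℂ} {m : Fin s → ℕ}
    (ha : drinfeldPoly Ω = ∏ j, (1 - C (a j) * X) ^ m j) [FiniteDimensional ℂ (genRep Ω)]
    (hI : hΩ.annihilator.IsRadical) : ∏ i, (T 1 - LaurentPolynomial.C (a i)) ∈ hΩ.annihilator := by
  obtain ⟨ι, _, φ, n, hφ, hn, hD, hP⟩ := hΩ.exists_isDrinfeldPolynomial_of_isRadical_annihilator hI
  have hprod := (hΩ.drinfeldPoly_eq_prod hD (hP (T 1))).symm.trans ha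
  refine hφ _ fun i => ?_
  obtain ⟨j, hj⟩ :=
    exists_eq_of_prod_pow_eq_prod_pow hprod (algHom_T_ne_zero (φ i) 1) (hn i).ne'
  rw [map_prod]
  refine Finset.prod_eq_zero (Finset.mem_univ j) ?_
  rw [map_sub, hj, sub_eq_zero]
  exact ((φ i).commutes (a j)).symm

end IsHighestWeightGenerator

end GenRep

end Sl2Loop

end

theorem mainTheorem3 {V : Type*} [AddCommGroup V] [Module ℂ V]
    [LieRingModule Sl2Loop.LoopSl2 V] [LieModule ℂ Sl2Loop.LoopSl2 V]
    (Ω : V) (hΩ : Sl2Loop.IsHighestWeightVector Ω)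
    (hfin : FiniteDimensional ℂ (Sl2Loop.genRep Ω))
    {s : ℕ} (a : Fin s → ℂ) (m : Fin s → ℕ)
    (ha : Sl2Loop.HasEvaluationParameters Ω a m) :
    LieModule.IsIrreducible ℂ Sl2Loop.LoopSl2 (Sl2Loop.genRep Ω) ↔
      ⁅Sl2Loop.xMinusParam a, Ω⁆ = 0 := by
  obtain ⟨D, hD⟩ := hΩ.exists_isHighestWeightGenerator
  rw [← hD.prod_T_sub_C_mem_annihilator_iff]
  refine ⟨fun hirr => ?_, fun hmem => ?_⟩
  · exact hD.prod_T_sub_C_mem_annihilator ha.factorization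
      (hD.isRadical_annihilator_of_isIrreducible hirr)
  · exact hD.isIrreducible_of_isRadical_annihilator
      (Sl2Loop.isRadical_of_prod_T_sub_C_mem ha.injective hmem)
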